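/- Let $n\ge 1$, let $p_1,\dots,p_n$ be distinct primes with $p_i\equiv 1 \pmod 4$, and let $N=p_1p_2\cdots p_n$. Let $\mathcal{QR}_N$ be the set of units of $\mathbb{Z}_N=\mathbb{Z}/N\mathbb{Z}$ that are squares in $\mathbb{Z}_N$. The Paley-type graph $\Gamma_N$ has vertex set $\mathbb{Z}_N$, and $a,b$ are adjacent if and only if $a-b\in\mathcal{QR}_N$. For a prime $p\equiv1\pmod 4$, $\Gamma_p$ is the Paley graph of the field $\mathbb{Z}_p$. The adjacency spectrum of a graph is the multiset of the eigenvalues of its adjacency matrix, counted with multiplicity. Then the adjacency spectrum of $\Gamma_N$ is the product of the adjacency spectra of the Paley graphs $\Gamma_{p_1},\dots,\Gamma_{p_n}$, that is, the multiset of all products $\lambda_1\lambda_2\cdots\lambda_n$, where each $\lambda_i$ runs through the spectrum of $\Gamma_{p_i}$ (with multiplicity). The graph $\Gamma_N$ has exactly $3^n$ distinct eigenvalues. They are the numbers $$\lambda_{T,\varepsilon}=\prod_{i\in T}\frac{-1+\varepsilon_i\sqrt{p_i}}{2}\;\prod_{i\notin T}\frac{p_i-1}{2},$$ where $T\subseteq\{1,\dots,n\}$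 and $\varepsilon\in\{1,-1\}^{T}$. These $3^n$ numbers are pairwise distinct, so each $T$ contributes exactly $2^{|T|}$ distinct eigenvalues. The multiplicity of $\lambda_{T,\varepsilon}$, both algebraic and geometric, is $$\prod_{i\in T}\frac{p_i-1}{2}.$$ -/

import Mathlib

/-- `QR_N`: the quadratic residues modulo `N` which are also units of `ℤ/N`. -/
def quadraticResidues (N : ℕ) : Set (ZMod N) := {x | IsUnit x ∧ IsSquare x}

/-- The Paley-type graph `Γ_N`: the Cayley graph of `(ℤ/N, +)` with connection set `QR_N`,
so that `a` and `b` are adjacent if and only if `a - b ∈ QR_N` (the connection set is symmetric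
as soon as `-1` is a square modulo `N`, see `paleyTypeGraph_adj`). -/
def paleyTypeGraph (N : ℕ) : SimpleGraph (ZMod N) :=
  SimpleGraph.circulantGraph (quadraticResidues N)

/-- The Paley graph of a field: the Cayley graph of its additive group with the nonzero squares as
connection set. -/
def paleyGraph (F : Type*) [Field F] : SimpleGraph F :=
  SimpleGraph.circulantGraph {x : F | x ≠ 0 ∧ IsSquare x}

theorem paleyTypeGraph_adj {N : ℕ} (hN : 1 < N) (h : IsSquare (-1 : ZMod N)) (a b : ZMod N) :
    (paleyTypeGraph N).Adj a b ↔ a - b ∈ quadraticResidues N := by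
  have : Fact (1 < N) := ⟨hN⟩
  simp only [paleyTypeGraph, SimpleGraph.circulantGraph, SimpleGraph.fromRel_adj,
    quadraticResidues, Set.mem_ofPred_eq]
  constructor
  · rintro ⟨_, h1 | ⟨hu, hs⟩⟩
    · exact h1
    · refine ⟨?_, ?_⟩
      · rw [← neg_sub]; exact hu.neg
      · have h2 := h.mul hs
        rwa [neg_one_mul, neg_sub] at h2
  · rintro ⟨hu, hs⟩
    refine ⟨?_, Or.inl ⟨hu, hs⟩⟩
    rintro rfl
    rw [sub_self] at hu
    exact not_isUnit_zero hu

open Classical in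
/-- The real adjacency matrix of a graph. -/
noncomputable def realAdjMatrix {V : Type*} (G : SimpleGraph V) : Matrix V V ℝ :=
  G.adjMatrix ℝ

open Classical in
/-- The adjacency spectrum of a finite graph: the multiset of the eigenvalues of its adjacency
matrix, each repeated according to its multiplicity. -/
noncomputable def adjSpectrum {V : Type*} [Fintype V] (G : SimpleGraph V) : Multiset ℝ :=
  (realAdjMatrix G).charpoly.roots

/-- The product of a family of multisets of real numbers: the multiset of all the products
`∏ i, x i`, where each `x i` runs through the multiset `S i`. -/
def spectraProd {n : ℕ} (S : Fin n → Multiset ℝ) : Multiset ℝ :=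
  (Multiset.pi Finset.univ.val S).map fun x => ∏ i : Fin n, x i (Finset.mem_univ i)

/-- The three numbers `(p - 1) / 2` (for `s = 0`) and `(-1 ± √p) / 2` (for `s = ± 1`). -/
noncomputable def paleyEigenvalue (p : ℕ) (s : SignType) : ℝ :=
  if s = 0 then ((p : ℝ) - 1) / 2 else (-1 + (s : ℝ) * √(p : ℝ)) / 2

/-- The numbers `1` (for `s = 0`) and `(p - 1) / 2` (for `s = ± 1`). -/
def paleyMultiplicity (p : ℕ) (s : SignType) : ℕ :=
  if s = 0 then 1 else (p - 1) / 2

/-!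
The Chinese remainder theorem `ZMod N ≃+* ∏ ZMod (p i)` carries units to tuples of nonzero elements
and squares to tuples of squares. Hence the adjacency matrix of `Γ_N` is, up to reindexing, the
Kronecker product of the adjacency matrices of the Paley graphs (`realAdjMatrix_paleyTypeGraph`). A
Kronecker product of diagonalized matrices is diagonalized by the products of the diagonal entries
(`IsDiagonalizedBy.piKronecker`), which gives the product formula for the spectrum, as well as all
algebraic and geometric multiplicities as cardinalities of fibres of the diagonal.

For one prime `p`, write `2A + 1 = J + Q` with `J` the all-ones matrix and `Q` the matrix of the
quadratic character. A Jacobi sum gives `Q² = p - J`, so `(2A + 1)² = p + (p - 1) J`, and every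
eigenvalue is `(p - 1) / 2` or `(-1 ± √p) / 2`. Since `A` has trace zero and `√p` is irrational, the
multiplicities have to be `1`, `(p - 1) / 2`, `(p - 1) / 2` (`exists_isDiagonalizedBy_paleyGraph`).

The products are distinct (`prod_paleyEigenvalue_injective`) because `√(p i)` is not in the field
generated by the square roots of the other primes: if two products agree but differ in the `i`-th
factor, the quotient of the two `i`-th factors lies in that field, and this forces `√(p i)` into it.
-/

/-! ### Diagonalized matrices and Kronecker products of families -/

/-- `IsDiagonalizedBy A d`: the square matrix `A` is similar to the diagonal matrix with diagonal
entries `d`. The inverse of the base change `P` is carried along as a second matrix `Q`. -/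
def IsDiagonalizedBy {V K : Type*} [Fintype V] [DecidableEq V] [CommRing K]
    (A : Matrix V V K) (d : V → K) : Prop :=
  ∃ P Q : Matrix V V K, P * Q = 1 ∧ A = P * Matrix.diagonal d * Q

namespace IsDiagonalizedBy

open Matrix

variable {V W K : Type*} [Fintype V] [DecidableEq V] [Fintype W] [DecidableEq W] [Field K]

theorem roots_charpoly {A : Matrix V V K} {d : V → K} (h : IsDiagonalizedBy A d) :
    A.charpoly.roots = Finset.univ.val.map d := by
  obtain ⟨P, Q, hPQ, rfl⟩ := h
  rw [charpoly_mul_comm, ← Matrix.mul_assoc, mul_eq_one_comm.mp hPQ, Matrix.one_mul,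
    charpoly_diagonal, Polynomial.roots_prod]
  · simp
  · simp [Finset.prod_ne_zero_iff, Polynomial.X_sub_C_ne_zero]

theorem finrank_eigenspace [DecidableEq K] {A : Matrix V V K} {d : V → K}
    (h : IsDiagonalizedBy A d) (μ : K) :
    Module.finrank K (Module.End.eigenspace (toLin' A) μ) =
      (Finset.univ.filter fun x => d x = μ).card := by
  obtain ⟨P, Q, hPQ, rfl⟩ := h
  have hQP := mul_eq_one_comm.mp hPQ
  have hP : IsUnit P := ⟨⟨P, Q, hPQ, hQP⟩, rfl⟩
  have hQ : IsUnit Q := ⟨⟨Q, P, hQP, hPQ⟩, rfl⟩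
  have hM : P * diagonal d * Q - μ • (1 : Matrix V V K)
      = P * diagonal (fun x => d x - μ) * Q := by
    have : diagonal (fun x => d x - μ) = diagonal d - μ • (1 : Matrix V V K) := by
      ext i j
      by_cases hij : i = j <;> simp [hij, diagonal, one_apply]
    rw [this, Matrix.mul_sub, Matrix.sub_mul]
    simp [hPQ]
  have hker : Module.End.eigenspace (toLin' (P * diagonal d * Q)) μ
      = LinearMap.ker (P * diagonal (fun x => d x - μ) * Q).mulVecLin := by
    ext v
    rw [Module.End.mem_eigenspace_iff, LinearMap.mem_ker, mulVecLin_apply, ← hM, sub_mulVec,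
      smul_mulVec, one_mulVec, sub_eq_zero, toLin'_apply]
  have hrank : (P * diagonal (fun x => d x - μ) * Q).rank
      = (Finset.univ.filter fun x => d x ≠ μ).card := by
    rw [rank_mul_eq_left_of_isUnit_det _ _ ((isUnit_iff_isUnit_det _).mp hQ),
      rank_mul_eq_right_of_isUnit_det _ _ ((isUnit_iff_isUnit_det _).mp hP), rank_diagonal,
      Fintype.card_subtype]
    simp [sub_eq_zero]
  have hsum := LinearMap.finrank_range_add_finrank_ker
    (P * diagonal (fun x => d x - μ) * Q).mulVecLin
  have hcard := Finset.card_filter_add_card_filter_not (s := (Finset.univ : Finset V))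
    (fun x => d x = μ)
  rw [← rank, hrank, Module.finrank_fintype_fun_eq_card] at hsum
  rw [Finset.card_univ] at hcard
  rw [hker]
  simp only [ne_eq] at hsum
  omega

theorem hasEigenvalue_iff {A : Matrix V V K} {d : V → K} (h : IsDiagonalizedBy A d) (μ : K) :
    Module.End.HasEigenvalue (toLin' A) μ ↔ μ ∈ Set.range d := by
  classical
  rw [Module.End.hasEigenvalue_iff, ne_eq, ← Submodule.finrank_eq_zero (R := K),
    h.finrank_eigenspace, Finset.card_eq_zero, Finset.filter_eq_empty_iff]
  simp

theorem submatrix {A : Matrix V V K} {d : V → K} (h : IsDiagonalizedBy A d) (e : W ≃ V) :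
    IsDiagonalizedBy (A.submatrix e e) (d ∘ e) := by
  obtain ⟨P, Q, hPQ, rfl⟩ := h
  refine ⟨P.submatrix e e, Q.submatrix e e, ?_, ?_⟩
  · rw [submatrix_mul_equiv, hPQ, submatrix_one_equiv]
  · rw [← submatrix_diagonal_equiv, submatrix_mul_equiv, submatrix_mul_equiv]

end IsDiagonalizedBy

theorem Matrix.IsHermitian.isDiagonalizedBy {V : Type*} [Fintype V] [DecidableEq V]
    {A : Matrix V V ℝ} (hA : A.IsHermitian) : IsDiagonalizedBy A hA.eigenvalues := by
  refine ⟨hA.eigenvectorUnitary, star (hA.eigenvectorUnitary : Matrix V V ℝ),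
    Unitary.coe_mul_star_self _, ?_⟩
  conv_lhs => rw [hA.spectral_theorem, Unitary.conjStarAlgAut_apply]
  rfl

/-- The Kronecker product of a finite family of square matrices, with rows and columns indexed by
the product of the index types. -/
def piKronecker {ι K : Type*} [Fintype ι] [CommRing K] {V : ι → Type*}
    (A : ∀ i, Matrix (V i) (V i) K) : Matrix (∀ i, V i) (∀ i, V i) K :=
  Matrix.of fun f g => ∏ i, A i (f i) (g i)

section PiKronecker

open Matrix

variable {ι K : Type*} [Fintype ι] [CommRing K] {V : ι → Type*}

theorem piKronecker_mul [DecidableEq ι] [∀ i, Fintype (V i)] (A B : ∀ i, Matrix (V i) (V i) K) :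
    piKronecker A * piKronecker B = piKronecker fun i => A i * B i := by
  ext f g
  simp only [piKronecker, mul_apply, of_apply, ← Finset.prod_mul_distrib]
  rw [Finset.prod_univ_sum, Fintype.piFinset_univ]

theorem piKronecker_diagonal [∀ i, DecidableEq (V i)] (d : ∀ i, V i → K) :
    piKronecker (fun i => diagonal (d i)) = diagonal fun f => ∏ i, d i (f i) := by
  ext f g
  by_cases hfg : f = g
  · simp [piKronecker, hfg]
  · obtain ⟨i, hi⟩ := Function.ne_iff.mp hfg
    rw [diagonal_apply_ne _ hfg]
    exact Finset.prod_eq_zero (Finset.mem_univ i) (diagonal_apply_ne _ hi)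

theorem IsDiagonalizedBy.piKronecker [DecidableEq ι] [∀ i, Fintype (V i)]
    [∀ i, DecidableEq (V i)] {A : ∀ i, Matrix (V i) (V i) K} {d : ∀ i, V i → K}
    (h : ∀ i, IsDiagonalizedBy (A i) (d i)) :
    IsDiagonalizedBy (piKronecker A) fun f => ∏ i, d i (f i) := by
  choose P Q hPQ hA using h
  refine ⟨_root_.piKronecker P, _root_.piKronecker Q, ?_, ?_⟩
  · rw [piKronecker_mul]
    simp only [hPQ, ← diagonal_one]
    rw [piKronecker_diagonal]
    simp
  · rw [← piKronecker_diagonal, piKronecker_mul, piKronecker_mul]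
    congr 1
    exact funext hA

end PiKronecker

theorem adjSpectrum_eq_of_isDiagonalizedBy {V : Type*} [Fintype V] [DecidableEq V]
    {G : SimpleGraph V} {d : V → ℝ} (h : IsDiagonalizedBy (realAdjMatrix G) d) :
    adjSpectrum G = Finset.univ.val.map d := by
  rw [← h.roots_charpoly, adjSpectrum]
  congr!

theorem Multiset.pi_map_right {ι : Type*} [DecidableEq ι] {V W : ι → Type*} (m : Multiset ι)
    (t : ∀ i, Multiset (V i)) (φ : ∀ i, V i → W i) :
    Multiset.pi m (fun i => (t i).map (φ i)) =
      (Multiset.pi m t).map fun f i hi => φ i (f i hi) := by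
  induction m using Multiset.induction_on with
  | empty =>
    simp only [Multiset.pi_zero, Multiset.map_singleton, Multiset.singleton_inj]
    funext i hi
    exact absurd hi (Multiset.notMem_zero i)
  | cons a m ih =>
    simp only [Multiset.pi_cons, ih, Multiset.bind_map, Multiset.map_bind, Multiset.map_map]
    refine Multiset.bind_congr fun x _ => Multiset.map_congr rfl fun f _ => ?_
    funext i hi
    by_cases h : i = a
    · subst h
      simp [Multiset.Pi.cons]
    · simp [Multiset.Pi.cons, h]

theorem spectraProd_map_univ {n : ℕ} {V : Fin n → Type*} [∀ i, Fintype (V i)]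
    (d : ∀ i, V i → ℝ) :
    spectraProd (fun i => Finset.univ.val.map (d i)) =
      (Finset.univ : Finset (∀ i, V i)).val.map fun f => ∏ i, d i (f i) := by
  rw [spectraProd, Multiset.pi_map_right, Multiset.map_map, ← Fintype.piFinset_univ]
  simp only [Fintype.piFinset, Finset.map_val, Multiset.map_map, Finset.pi]
  rfl

/-! ### Independence of the square roots of distinct primes -/

/-- The elements `a + b * x` with `a`, `b` in a field `K` containing `x ^ 2` form a field. -/
theorem Subfield.exists_le_forall_eq_add_mul (K : Subfield ℝ) {x : ℝ} (hx : x ^ 2 ∈ K) :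
    ∃ L : Subfield ℝ, K ≤ L ∧ x ∈ L ∧ ∀ y ∈ L, ∃ a ∈ K, ∃ b ∈ K, y = a + b * x := by
  by_cases hxK : x ∈ K
  · exact ⟨K, le_rfl, hxK, fun y hy => ⟨y, hy, 0, K.zero_mem, by ring⟩⟩
  refine ⟨{ carrier := {y | ∃ a ∈ K, ∃ b ∈ K, y = a + b * x}
            mul_mem' := ?_, one_mem' := ?_, add_mem' := ?_, zero_mem' := ?_, neg_mem' := ?_,
            inv_mem' := ?_ }, ?_, ?_, fun y hy => hy⟩
  · rintro _ _ ⟨a, ha, b, hb, rfl⟩ ⟨c, hc, d, hd, rfl⟩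
    exact ⟨a * c + b * d * x ^ 2,
      K.add_mem (K.mul_mem ha hc) (K.mul_mem (K.mul_mem hb hd) hx),
      a * d + b * c, K.add_mem (K.mul_mem ha hd) (K.mul_mem hb hc), by ring⟩
  · exact ⟨1, K.one_mem, 0, K.zero_mem, by ring⟩
  · rintro _ _ ⟨a, ha, b, hb, rfl⟩ ⟨c, hc, d, hd, rfl⟩
    exact ⟨a + c, K.add_mem ha hc, b + d, K.add_mem hb hd, by ring⟩
  · exact ⟨0, K.zero_mem, 0, K.zero_mem, by ring⟩
  · rintro _ ⟨a, ha, b, hb, rfl⟩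
    exact ⟨-a, K.neg_mem ha, -b, K.neg_mem hb, by ring⟩
  · rintro _ ⟨a, ha, b, hb, rfl⟩
    by_cases hb0 : b = 0
    · exact ⟨a⁻¹, K.inv_mem ha, 0, K.zero_mem, by simp [hb0]⟩
    -- Both conjugates are nonzero, as `x ∉ K`; hence so is the norm `a ^ 2 - b ^ 2 * x ^ 2`.
    have h1 : a + b * x ≠ 0 := fun h => hxK <| by
      rw [show x = -a / b by field_simp; linarith]
      exact K.div_mem (K.neg_mem ha) hb
    have h2 : a - b * x ≠ 0 := fun h => hxK <| by
      rw [show x = a / b by field_simp; linarith]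
      exact K.div_mem ha hb
    have hn : a ^ 2 - b ^ 2 * x ^ 2 ∈ K :=
      K.sub_mem (K.pow_mem ha 2) (K.mul_mem (K.pow_mem hb 2) hx)
    have hn0 : a ^ 2 - b ^ 2 * x ^ 2 ≠ 0 := by
      rw [show a ^ 2 - b ^ 2 * x ^ 2 = (a + b * x) * (a - b * x) by ring]
      exact mul_ne_zero h1 h2
    refine ⟨a / (a ^ 2 - b ^ 2 * x ^ 2), K.div_mem ha hn, -b / (a ^ 2 - b ^ 2 * x ^ 2),
      K.div_mem (K.neg_mem hb) hn, ?_⟩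
    rw [inv_eq_iff_eq_inv, eq_comm, inv_eq_iff_eq_inv, eq_comm, inv_eq_one_div, eq_comm]
    field_simp
    ring
  · exact fun a ha => ⟨a, ha, 0, K.zero_mem, by ring⟩
  · exact ⟨0, K.zero_mem, 1, K.one_mem, by ring⟩

/-- The easy half of Kummer theory for square roots: a rational number which has a square root in
`ℚ(√q : q ∈ S)` is a square up to a product of elements of `S`. -/
theorem exists_subfield_sqrt_mem_forall_isSquare (S : Finset ℕ) :
    ∃ K : Subfield ℝ, (∀ q ∈ S, √(q : ℝ) ∈ K) ∧
      ∀ x ∈ K, ∀ d : ℚ, x ^ 2 = d → ∃ T ⊆ S, IsSquare (d * ∏ q ∈ T, (q : ℚ)) := by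
  induction S using Finset.induction_on with
  | empty =>
    refine ⟨(algebraMap ℚ ℝ).fieldRange, by simp, ?_⟩
    rintro _ ⟨r, rfl⟩ d hd
    refine ⟨∅, subset_rfl, r, ?_⟩
    rw [eq_ratCast] at hd
    rw [Finset.prod_empty, mul_one, ← sq]
    exact_mod_cast hd.symm
  | insert q S hq ih =>
    obtain ⟨K, hSK, hK⟩ := ih
    have hsq : √(q : ℝ) ^ 2 = q := Real.sq_sqrt (Nat.cast_nonneg q)
    obtain ⟨L, hKL, hqL, hL⟩ := K.exists_le_forall_eq_add_mul (x := √(q : ℝ))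
      (by rw [hsq]; exact natCast_mem K q)
    refine ⟨L, ?_, ?_⟩
    · intro r hr
      rcases Finset.mem_insert.mp hr with rfl | hr
      · exact hqL
      · exact hKL (hSK r hr)
    intro x hx d hd
    have key : x ∈ K → ∃ T ⊆ insert q S, IsSquare (d * ∏ q ∈ T, (q : ℚ)) := fun hxK => by
      obtain ⟨T, hT, h⟩ := hK x hxK d hd
      exact ⟨T, hT.trans (Finset.subset_insert _ _), h⟩
    obtain ⟨a, ha, b, hb, rfl⟩ := hL x hx
    by_cases hb0 : b = 0
    · exact key (by simpa [hb0] using ha)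
    by_cases ha0 : a = 0
    · subst ha0
      obtain ⟨T, hT, h⟩ := hK (b * q) (K.mul_mem hb (natCast_mem K q)) (d * q) (by
        push_cast
        linear_combination (q : ℝ) * hd - b ^ 2 * q * hsq)
      refine ⟨insert q T, Finset.insert_subset_insert _ hT, ?_⟩
      rwa [Finset.prod_insert fun h => hq (hT h), ← mul_assoc]
    · -- Expanding the square shows that `√q` is already in `K`.
      refine key (K.add_mem ha (K.mul_mem hb ?_))
      rw [show √(q : ℝ) = (d - a ^ 2 - b ^ 2 * q) / (2 * a * b) by
        field_simp
        linear_combination hd - b ^ 2 * hsq]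
      exact K.div_mem (K.sub_mem (K.sub_mem (SubfieldClass.ratCast_mem K d) (K.pow_mem ha 2))
        (K.mul_mem (K.pow_mem hb 2) (natCast_mem K q)))
        (K.mul_mem (K.mul_mem (ofNat_mem K 2) ha) hb)

theorem exists_subfield_sqrt_mem_sqrt_notMem {S : Finset ℕ} (hS : ∀ q ∈ S, q.Prime) {p : ℕ}
    (hp : p.Prime) (hpS : p ∉ S) :
    ∃ K : Subfield ℝ, (∀ q ∈ S, √(q : ℝ) ∈ K) ∧ √(p : ℝ) ∉ K := by
  obtain ⟨K, hSK, hK⟩ := exists_subfield_sqrt_mem_forall_isSquare S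
  refine ⟨K, hSK, fun hpK => ?_⟩
  obtain ⟨T, hT, h⟩ := hK _ hpK p (by simp)
  have h' : IsSquare (p * ∏ q ∈ T, q) := by
    rw [← Rat.isSquare_natCast_iff]
    push_cast
    exact h
  obtain ⟨m, hm⟩ := h'
  obtain ⟨k, rfl⟩ : p ∣ m := by
    rcases hp.dvd_mul.mp (hm ▸ dvd_mul_right p _) with h | h <;> exact h
  have hdvd : p ∣ ∏ q ∈ T, q :=
    ⟨k * k, Nat.eq_of_mul_eq_mul_left hp.pos (by rw [hm]; ring)⟩
  obtain ⟨q, hqT, hpq⟩ := (hp.prime.dvd_finsetProd_iff _).mp hdvd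
  rw [(Nat.prime_dvd_prime_iff_eq hp (hS q (hT hqT))).mp hpq] at hpS
  exact hpS (hT hqT)

/-! ### The numbers in the table -/

theorem paleyEigenvalue_eq_add_mul_sqrt (p : ℕ) (s : SignType) :
    paleyEigenvalue p s =
      (if s = 0 then ((p : ℝ) - 1) / 2 else -1 / 2) + ((s : ℤ) : ℝ) / 2 * √(p : ℝ) := by
  cases s <;> simp [paleyEigenvalue] <;> ring

theorem paleyEigenvalue_ne_zero {p : ℕ} (hp : p.Prime) (s : SignType) :
    paleyEigenvalue p s ≠ 0 := by
  have h1 : (1 : ℝ) < p := by exact_mod_cast hp.one_lt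
  have h2 : 1 < √(p : ℝ) := by rw [Real.lt_sqrt] <;> linarith
  cases s <;> simp [paleyEigenvalue] <;> intro h <;> linarith

/-- Two of the three numbers attached to `p` can only be proportional over a field which
contains `√p`. -/
theorem sqrt_mem_of_paleyEigenvalue_eq_mul {K : Subfield ℝ} {p : ℕ} (hp : p.Prime)
    {s t : SignType} (hst : s ≠ t) {c : ℝ} (hc : c ∈ K)
    (h : paleyEigenvalue p s = c * paleyEigenvalue p t) : √(p : ℝ) ∈ K := by
  have h1 : (1 : ℝ) < p := by exact_mod_cast hp.one_lt
  rw [paleyEigenvalue_eq_add_mul_sqrt, paleyEigenvalue_eq_add_mul_sqrt] at h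
  have hmem : ∀ r : SignType, (if r = 0 then ((p : ℝ) - 1) / 2 else -1 / 2) ∈ K := fun r => by
    split_ifs
    · exact K.div_mem (K.sub_mem (natCast_mem K p) K.one_mem) (ofNat_mem K 2)
    · exact K.div_mem (K.neg_mem K.one_mem) (ofNat_mem K 2)
  have hmem' : ∀ r : SignType, ((r : ℤ) : ℝ) / 2 ∈ K := fun r =>
    K.div_mem (intCast_mem K _) (ofNat_mem K 2)
  -- The coordinate vectors of the two numbers with respect to `1, √p` are not proportional.
  have hdet : (if s = 0 then ((p : ℝ) - 1) / 2 else -1 / 2) * (((t : ℤ) : ℝ) / 2) ≠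
      (if t = 0 then ((p : ℝ) - 1) / 2 else -1 / 2) * (((s : ℤ) : ℝ) / 2) := by
    intro h
    cases s <;> cases t <;> simp at hst h <;> linarith
  have ha := hmem s
  have ha' := hmem t
  have hb := hmem' s
  have hb' := hmem' t
  generalize (if s = 0 then ((p : ℝ) - 1) / 2 else -1 / 2) = a at *
  generalize (if t = 0 then ((p : ℝ) - 1) / 2 else -1 / 2) = a' at *
  generalize ((s : ℤ) : ℝ) / 2 = b at *
  generalize ((t : ℤ) : ℝ) / 2 = b' at *
  have hne : b - c * b' ≠ 0 := fun h0 => hdet <| by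
    have h2 : b = c * b' := by linarith
    have h3 : a = c * a' := by
      rw [h2] at h
      linarith
    rw [h2, h3]
    ring
  rw [show √(p : ℝ) = (c * a' - a) / (b - c * b') by
    rw [eq_div_iff hne]
    linarith]
  exact K.div_mem (K.sub_mem (K.mul_mem hc ha') ha) (K.sub_mem hb (K.mul_mem hc hb'))

/-- The `3 ^ n` products are pairwise distinct: if two of them agree and differ in the `i`-th
factor, then `√(p i)` lies in the field generated by the other square roots. -/
theorem prod_paleyEigenvalue_injective {ι : Type*} [Fintype ι] {p : ι → ℕ}
    (hp : ∀ i, (p i).Prime) (hp_inj : Function.Injective p) :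
    Function.Injective (fun s : ι → SignType => ∏ i, paleyEigenvalue (p i) (s i)) := by
  classical
  intro s t hst
  by_contra hne
  obtain ⟨i, hi⟩ := Function.ne_iff.mp hne
  obtain ⟨K, hK, hiK⟩ := exists_subfield_sqrt_mem_sqrt_notMem
    (S := (Finset.univ.erase i).image p) (by simp [hp]) (hp i) (by
      simp only [Finset.mem_image, Finset.mem_erase, Finset.mem_univ, and_true, not_exists,
        not_and]
      exact fun j hj h => hj (hp_inj h))
  have hmem : ∀ u : ι → SignType, ∏ j ∈ Finset.univ.erase i, paleyEigenvalue (p j) (u j) ∈ K := by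
    refine fun u => K.prod_mem fun j hj => ?_
    rw [paleyEigenvalue_eq_add_mul_sqrt]
    refine K.add_mem ?_ (K.mul_mem (K.div_mem (intCast_mem K _) (ofNat_mem K 2))
      (hK _ (Finset.mem_image_of_mem p hj)))
    split_ifs
    · exact K.div_mem (K.sub_mem (natCast_mem K _) K.one_mem) (ofNat_mem K 2)
    · exact K.div_mem (K.neg_mem K.one_mem) (ofNat_mem K 2)
  have h0 : ∏ j ∈ Finset.univ.erase i, paleyEigenvalue (p j) (s j) ≠ 0 :=
    Finset.prod_ne_zero_iff.mpr fun j _ => paleyEigenvalue_ne_zero (hp j) _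
  refine hiK (sqrt_mem_of_paleyEigenvalue_eq_mul (hp i) hi (K.div_mem (hmem t) (hmem s)) ?_)
  simp only [← Finset.mul_prod_erase _ _ (Finset.mem_univ i)] at hst
  field_simp
  linarith

theorem ncard_prod_paleyEigenvalue_of_support {ι : Type*} [Fintype ι] {p : ι → ℕ}
    (hp : ∀ i, (p i).Prime) (hp_inj : Function.Injective p) (T : Finset ι) :
    {μ : ℝ | ∃ s : ι → SignType, (∀ i, s i ≠ 0 ↔ i ∈ T) ∧
      μ = ∏ i, paleyEigenvalue (p i) (s i)}.ncard = 2 ^ T.card := by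
  classical
  have himage : {μ : ℝ | ∃ s : ι → SignType, (∀ i, s i ≠ 0 ↔ i ∈ T) ∧
      μ = ∏ i, paleyEigenvalue (p i) (s i)} =
      (fun s : ι → SignType => ∏ i, paleyEigenvalue (p i) (s i)) ''
        (Fintype.piFinset fun i => if i ∈ T then ({1, -1} : Finset SignType) else {0}) := by
    ext μ
    simp only [Set.mem_ofPred_eq, Set.mem_image, Finset.mem_coe, Fintype.mem_piFinset]
    refine exists_congr fun s => and_congr (forall_congr' fun i => ?_) eq_comm
    by_cases hi : i ∈ T
    all_goals
      simp only [hi, if_true, if_false, iff_true, iff_false]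
      cases s i <;> decide
  rw [himage, Set.ncard_image_of_injective _ (prod_paleyEigenvalue_injective hp hp_inj),
    Set.ncard_coe_finset, Fintype.card_piFinset]
  have hcard : ∀ i, (if i ∈ T then ({1, -1} : Finset SignType) else {0}).card =
      if i ∈ T then 2 else 1 := fun i => by split_ifs <;> rfl
  simp only [hcard]
  simp

/-! ### The spectrum of a Paley graph -/

theorem ringChar_ne_two_of_card {F : Type*} [Field F] [Fintype F]
    (hF : Fintype.card F % 4 = 1) : ringChar F ≠ 2 := fun h => by
  have := FiniteField.even_card_iff_char_two.mp h
  omega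

section PaleyGraph

open Matrix

variable {F : Type*} [Field F] [Fintype F] [DecidableEq F]

theorem quadraticChar_neg_of_card (hF : Fintype.card F % 4 = 1) (a : F) :
    quadraticChar F (-a) = quadraticChar F a := by
  have h : IsSquare (-1 : F) := FiniteField.isSquare_neg_one_iff.mpr (by omega)
  have h1 := (quadraticChar_one_iff_isSquare (neg_ne_zero.mpr one_ne_zero)).mpr h
  rw [← neg_one_mul, map_mul, h1, one_mul]

theorem sum_quadraticChar_sub (hF : Fintype.card F % 4 = 1) (a : F) :
    ∑ b, (quadraticChar F (a - b) : ℝ) = 0 := by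
  rw [← Int.cast_sum, Fintype.sum_equiv (Equiv.subLeft a) (fun b => quadraticChar F (a - b))
    (fun b => quadraticChar F b) fun b => rfl,
    quadraticChar_sum_zero (ringChar_ne_two_of_card hF), Int.cast_zero]

/-- The convolution of the quadratic character with itself; off the diagonal it is a Jacobi
sum. -/
theorem sum_quadraticChar_sub_mul (hF : Fintype.card F % 4 = 1) (a b : F) :
    ∑ c, quadraticChar F (a - c) * quadraticChar F (c - b) =
      if a = b then (Fintype.card F : ℤ) - 1 else -1 := by
  split_ifs with hab
  · subst hab
    have hterm : ∀ c, quadraticChar F (a - c) * quadraticChar F (c - a) =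
        1 - if c = a then 1 else 0 := fun c => by
      rw [← neg_sub c a, quadraticChar_neg_of_card hF, ← sq]
      split_ifs with h
      · simp [h]
      · rw [quadraticChar_sq_one (sub_ne_zero.mpr h), sub_zero]
    simp only [hterm, Finset.sum_sub_distrib]
    simp
  · have hd : a - b ≠ 0 := sub_ne_zero.mpr hab
    have hJ := jacobiSum_nontrivial_inv (quadraticChar_ne_one (ringChar_ne_two_of_card hF))
    rw [(quadraticChar_isQuadratic F).inv, quadraticChar_neg_of_card hF, map_one, jacobiSum] at hJ
    rw [← hJ]
    -- Substitute `c = a - x * (a - b)`.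
    symm
    refine Fintype.sum_equiv ((Equiv.mulRight₀ (a - b) hd).trans (Equiv.subLeft a)) _ _ fun x => ?_
    have h1 : a - ((Equiv.mulRight₀ (a - b) hd).trans (Equiv.subLeft a)) x = x * (a - b) := by
      simp
    have h2 : ((Equiv.mulRight₀ (a - b) hd).trans (Equiv.subLeft a)) x - b =
        (1 - x) * (a - b) := by
      simp only [Equiv.trans_apply, Equiv.mulRight₀_apply, Equiv.subLeft_apply]
      ring
    rw [h1, h2, map_mul, map_mul]
    have := quadraticChar_sq_one hd
    linear_combination (-quadraticChar F x * quadraticChar F (1 - x)) * this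

theorem two_mul_realAdjMatrix_paleyGraph (hF : Fintype.card F % 4 = 1) (a b : F) :
    2 * realAdjMatrix (paleyGraph F) a b =
      1 + (quadraticChar F (a - b) : ℝ) - (1 : Matrix F F ℝ) a b := by
  by_cases hab : a = b
  · subst hab
    simp [realAdjMatrix]
  have hd : a - b ≠ 0 := sub_ne_zero.mpr hab
  have hd' : b - a ≠ 0 := sub_ne_zero.mpr (Ne.symm hab)
  have hadj : (paleyGraph F).Adj a b ↔ quadraticChar F (a - b) = 1 := by
    have h' : IsSquare (b - a) ↔ IsSquare (a - b) := by
      rw [← quadraticChar_one_iff_isSquare hd, ← quadraticChar_one_iff_isSquare hd',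
        ← neg_sub a b, quadraticChar_neg_of_card hF]
    rw [quadraticChar_one_iff_isSquare hd]
    simp [paleyGraph, hab, hd, hd', h']
  rw [realAdjMatrix, SimpleGraph.adjMatrix_apply, one_apply_ne hab]
  rcases quadraticChar_dichotomy hd with h | h
  · rw [if_pos (hadj.mpr h), h]
    norm_num
  · rw [if_neg (by rw [hadj, h]; decide), h]
    norm_num

theorem sum_realAdjMatrix_paleyGraph (hF : Fintype.card F % 4 = 1) (a : F) :
    ∑ b, realAdjMatrix (paleyGraph F) a b = ((Fintype.card F : ℝ) - 1) / 2 := by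
  have h : 2 * ∑ b, realAdjMatrix (paleyGraph F) a b = (Fintype.card F : ℝ) - 1 := by
    rw [Finset.mul_sum]
    simp only [two_mul_realAdjMatrix_paleyGraph hF, Finset.sum_sub_distrib, Finset.sum_add_distrib,
      sum_quadraticChar_sub hF]
    simp [one_apply]
  linarith

/-- In terms of the adjacency matrix `A` and the all-ones matrix `J`: `(2A + 1)² = q + (q - 1) J`,
which holds because `2A + 1 = J + Q` with `Q` the matrix of the quadratic character. -/
theorem two_mul_realAdjMatrix_paleyGraph_add_one_sq_apply (hF : Fintype.card F % 4 = 1) (a b : F) :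
    ((2 * realAdjMatrix (paleyGraph F) + 1) * (2 * realAdjMatrix (paleyGraph F) + 1) :
      Matrix F F ℝ) a b =
      (Fintype.card F : ℝ) * (1 : Matrix F F ℝ) a b + ((Fintype.card F : ℝ) - 1) := by
  have hB : 2 * realAdjMatrix (paleyGraph F) + 1 =
      of fun a b : F => 1 + (quadraticChar F (a - b) : ℝ) := by
    ext a b
    rw [two_mul, Matrix.add_apply, Matrix.add_apply, ← two_mul, two_mul_realAdjMatrix_paleyGraph hF, of_apply]
    ring
  have hs : ∑ c, (quadraticChar F (c - b) : ℝ) = 0 := by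
    rw [← sum_quadraticChar_sub hF b]
    simp only [← neg_sub b, quadraticChar_neg_of_card hF]
  have hs3 : ∑ c, (quadraticChar F (a - c) : ℝ) * (quadraticChar F (c - b) : ℝ) =
      if a = b then (Fintype.card F : ℝ) - 1 else -1 := by
    have := congrArg (Int.cast : ℤ → ℝ) (sum_quadraticChar_sub_mul hF a b)
    push_cast at this
    exact this
  rw [hB, mul_apply]
  simp only [of_apply, add_mul, mul_add, one_mul, mul_one, Finset.sum_add_distrib,
    sum_quadraticChar_sub hF, hs, hs3]
  by_cases hab : a = b
  · subst hab
    simp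
  · simp [hab]
    ring

/-- Every eigenvalue `μ` of a Paley graph is a root of a cubic polynomial: an eigenvector `v` with
`(2μ + 1)² ≠ q` is, by the formula for `(2A + 1)²`, a multiple of the all-ones vector, whose
eigenvalue is the degree `(q - 1) / 2`. -/
theorem sub_mul_sub_eq_zero_of_mulVec_eq (hF : Fintype.card F % 4 = 1) {v : F → ℝ} (hv : v ≠ 0)
    {μ : ℝ} (h : realAdjMatrix (paleyGraph F) *ᵥ v = μ • v) :
    (μ - ((Fintype.card F : ℝ) - 1) / 2) * ((2 * μ + 1) ^ 2 - Fintype.card F) = 0 := by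
  set A := realAdjMatrix (paleyGraph F) with hA
  set q := (Fintype.card F : ℝ) with hq
  have hB : (2 * A + 1) *ᵥ v = (2 * μ + 1) • v := by
    rw [two_mul, add_mulVec, add_mulVec, one_mulVec, h, add_smul, one_smul, two_mul, add_smul]
  have hBB : ((2 * A + 1) * (2 * A + 1)) *ᵥ v = (2 * μ + 1) ^ 2 • v := by
    rw [← mulVec_mulVec, hB, mulVec_smul, hB, smul_smul, sq]
  have hBB' : ((2 * A + 1) * (2 * A + 1)) *ᵥ v = q • v + fun _ => (q - 1) * ∑ x, v x := by
    ext a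
    simp only [mulVec, dotProduct, hA, two_mul_realAdjMatrix_paleyGraph_add_one_sq_apply hF]
    simp only [add_mul, Finset.sum_add_distrib, Pi.add_apply, Pi.smul_apply, smul_eq_mul,
      ← Finset.mul_sum, mul_assoc]
    simp [one_apply, hq]
  have hconst : (fun _ => (q - 1) * ∑ x, v x : F → ℝ) = ((2 * μ + 1) ^ 2 - q) • v := by
    rw [sub_smul, ← hBB, hBB']
    simp
  have hAc : A *ᵥ (fun _ => (q - 1) * ∑ x, v x : F → ℝ) =
      ((q - 1) / 2) • (fun _ => (q - 1) * ∑ x, v x : F → ℝ) := by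
    ext a
    simp only [mulVec, dotProduct, ← Finset.sum_mul, Pi.smul_apply, smul_eq_mul]
    rw [sum_realAdjMatrix_paleyGraph hF]
  rw [hconst, mulVec_smul, h, smul_smul, smul_smul, ← sub_eq_zero, ← sub_smul] at hAc
  have := (smul_eq_zero.mp hAc).resolve_right hv
  linear_combination this

end PaleyGraph

theorem isHermitian_realAdjMatrix {V : Type*} (G : SimpleGraph V) :
    (realAdjMatrix G).IsHermitian := by
  classical
  rw [Matrix.IsHermitian, Matrix.conjTranspose_eq_transpose_of_trivial]
  exact SimpleGraph.transpose_adjMatrix G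

/-- The adjacency matrix of the Paley graph of `ZMod p` is diagonalized by the three numbers
`paleyEigenvalue p s`, with multiplicities `paleyMultiplicity p s`. The multiplicities come from
the trace: its vanishing is a linear relation between `1` and the irrational number `√p`. -/
theorem exists_isDiagonalizedBy_paleyGraph (p : ℕ) [hp : Fact p.Prime] (hmod : p ≡ 1 [MOD 4]) :
    ∃ σ : ZMod p → SignType,
      IsDiagonalizedBy (realAdjMatrix (paleyGraph (ZMod p))) (fun x => paleyEigenvalue p (σ x)) ∧
      ∀ s, (Finset.univ.filter fun x => σ x = s).card = paleyMultiplicity p s := by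
  have hmod' : p % 4 = 1 := hmod
  have hF : Fintype.card (ZMod p) % 4 = 1 := by rw [ZMod.card]; exact hmod
  have hA := isHermitian_realAdjMatrix (paleyGraph (ZMod p))
  have hval : ∀ x, ∃ s, paleyEigenvalue p s = hA.eigenvalues x := fun x => by
    have h0 := sub_mul_sub_eq_zero_of_mulVec_eq hF
      (v := (hA.eigenvectorBasis x).ofLp)
      (fun h => hA.eigenvectorBasis.orthonormal.ne_zero x ((WithLp.ofLp_eq_zero 2).mp h))
      (hA.mulVec_eigenvectorBasis x)
    rw [ZMod.card] at h0
    rcases mul_eq_zero.mp h0 with h | h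
    · exact ⟨0, by simp only [paleyEigenvalue, if_true]; linarith⟩
    · have hsq : (2 * hA.eigenvalues x + 1) ^ 2 = √(p : ℝ) ^ 2 := by
        rw [Real.sq_sqrt (Nat.cast_nonneg p)]
        linarith
      rcases sq_eq_sq_iff_eq_or_eq_neg.mp hsq with h | h
      · exact ⟨1, by simp [paleyEigenvalue]; linarith⟩
      · exact ⟨-1, by simp [paleyEigenvalue]; linarith⟩
  choose σ hσ using hval
  have hdiag : IsDiagonalizedBy (realAdjMatrix (paleyGraph (ZMod p)))
      (fun x => paleyEigenvalue p (σ x)) := by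
    simp only [hσ]
    exact hA.isDiagonalizedBy
  refine ⟨σ, hdiag, ?_⟩
  have huniv : (Finset.univ : Finset SignType) = {0, 1, -1} := by decide
  have hcard := Finset.card_eq_sum_card_fiberwise (f := σ) (s := Finset.univ)
    (t := Finset.univ) (fun _ _ => Finset.mem_univ _)
  have htrace : ∑ x, paleyEigenvalue p (σ x) = 0 := by
    have h1 := hA.trace_eq_sum_eigenvalues
    have h2 : (realAdjMatrix (paleyGraph (ZMod p))).trace = 0 := by
      simp [Matrix.trace, realAdjMatrix]
    rw [h2] at h1
    simp only [hσ]
    exact h1.symm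
  rw [← Finset.sum_fiberwise' (g := σ) Finset.univ (fun s => paleyEigenvalue p s)] at htrace
  simp only [Finset.sum_const, huniv, nsmul_eq_mul] at htrace hcard
  rw [Finset.sum_insert (by decide), Finset.sum_insert (by decide), Finset.sum_singleton]
    at htrace hcard
  rw [Finset.card_univ, ZMod.card] at hcard
  generalize h0 : (Finset.univ.filter fun x => σ x = 0).card = m₀ at *
  generalize h1 : (Finset.univ.filter fun x => σ x = 1).card = m₁ at *
  generalize h2 : (Finset.univ.filter fun x => σ x = -1).card = m₂ at *
  have hcardR : (p : ℝ) = m₀ + (m₁ + m₂) := by exact_mod_cast hcard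
  simp [paleyEigenvalue] at htrace
  have h12 : m₁ = m₂ := by
    by_contra hne
    have hne' : (m₁ : ℝ) - m₂ ≠ 0 := sub_ne_zero.mpr (by exact_mod_cast hne)
    refine hp.out.irrational_sqrt ⟨((m₁ + m₂ : ℚ) - m₀ * (p - 1)) / (m₁ - m₂), ?_⟩
    push_cast
    rw [div_eq_iff hne']
    linarith
  have hp2 := hp.out.two_le
  have hm₀ : m₀ = 1 := by
    have h3 : (m₀ : ℝ) * p = p := by
      rw [h12] at htrace hcardR
      linarith
    have hp0 : (p : ℝ) ≠ 0 := by exact_mod_cast hp.out.ne_zero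
    exact_mod_cast mul_right_cancel₀ hp0 (h3.trans (one_mul _).symm)
  intro s
  cases s
  · exact h0.trans hm₀
  · refine h2.trans ?_
    simp [paleyMultiplicity]
    omega
  · refine h1.trans ?_
    simp [paleyMultiplicity]
    omega

/-! ### The Chinese remainder theorem for the graphs -/

theorem mem_quadraticResidues_prod_iff {ι : Type*} [Fintype ι] {N : ℕ} {p : ι → ℕ}
    [∀ i, Fact (p i).Prime] (e : ZMod N ≃+* ∀ i, ZMod (p i)) (x : ZMod N) :
    x ∈ quadraticResidues N ↔ ∀ i, e x i ≠ 0 ∧ IsSquare (e x i) := by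
  have hu : IsUnit x ↔ ∀ i, e x i ≠ 0 := by
    rw [← MulEquiv.isUnit_map e, Pi.isUnit_iff]
    simp only [isUnit_iff_ne_zero]
  have hs : IsSquare x ↔ ∀ i, IsSquare (e x i) := by
    constructor
    · rintro ⟨y, rfl⟩ i
      exact ⟨e y i, by rw [map_mul, Pi.mul_apply]⟩
    · intro h
      choose y hy using h
      exact ⟨e.symm y, e.injective (by rw [map_mul, e.apply_symm_apply]; exact funext hy)⟩
  change IsUnit x ∧ IsSquare x ↔ _
  rw [hu, hs, forall_and]

theorem realAdjMatrix_paleyTypeGraph {ι : Type*} [Fintype ι] {p : ι → ℕ}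
    [∀ i, Fact (p i).Prime] (hp_mod : ∀ i, p i ≡ 1 [MOD 4]) {N : ℕ}
    (hN1 : 1 < N) (e : ZMod N ≃+* ∀ i, ZMod (p i)) :
    realAdjMatrix (paleyTypeGraph N) =
      (piKronecker fun i => realAdjMatrix (paleyGraph (ZMod (p i)))).submatrix e e := by
  have hneg : ∀ i, IsSquare (-1 : ZMod (p i)) := fun i => by
    have := hp_mod i
    rw [FiniteField.isSquare_neg_one_iff, ZMod.card]
    unfold Nat.ModEq at this
    omega
  have hadj : ∀ a b, (paleyTypeGraph N).Adj a b ↔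
      ∀ i, (paleyGraph (ZMod (p i))).Adj (e a i) (e b i) := fun a b => by
    have hi : ∀ i, (paleyGraph (ZMod (p i))).Adj (e a i) (e b i) ↔
        e (a - b) i ≠ 0 ∧ IsSquare (e (a - b) i) := fun i => by
      rw [map_sub, Pi.sub_apply]
      have hsymm : IsSquare (e b i - e a i) ↔ IsSquare (e a i - e b i) := by
        constructor <;> intro h <;> simpa using (hneg i).mul h
      simp only [paleyGraph, SimpleGraph.circulantGraph_adj, Set.mem_ofPred_eq, hsymm, sub_ne_zero]
      tauto
    have hN : IsSquare (-1 : ZMod N) := by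
      choose y hy using hneg
      exact ⟨e.symm y, e.injective (by
        rw [map_mul, e.apply_symm_apply, map_neg, map_one]
        exact funext hy)⟩
    rw [paleyTypeGraph_adj hN1 hN, mem_quadraticResidues_prod_iff e]
    simp only [hi]
  ext a b
  simp only [realAdjMatrix, piKronecker, SimpleGraph.adjMatrix_apply, Matrix.submatrix_apply,
    Matrix.of_apply]
  by_cases h : ∀ i, (paleyGraph (ZMod (p i))).Adj (e a i) (e b i)
  · rw [if_pos ((hadj a b).mpr h)]
    simp [h]
  · obtain ⟨i, hi⟩ := not_forall.mp h
    rw [if_neg fun h' => h ((hadj a b).mp h')]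
    exact (Finset.prod_eq_zero (Finset.mem_univ i) (if_neg hi)).symm

/-! ### The spectrum of the Paley-type graph -/

theorem mainTheorem1 (n : ℕ) (hn : 1 ≤ n) (p : Fin n → ℕ) [hp : ∀ i, Fact (p i).Prime]
    (hp_inj : Function.Injective p) (hp_mod : ∀ i, p i ≡ 1 [MOD 4])
    (N : ℕ) [NeZero N] (hN : N = ∏ i, p i) :
    -- the spectrum of `Γ_N` is the product of the spectra of the Paley graphs `Γ_{p i}`
    adjSpectrum (paleyTypeGraph N) =
        spectraProd (fun i => adjSpectrum (paleyGraph (ZMod (p i)))) ∧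
    -- there are exactly `3 ^ n` distinct eigenvalues
    {μ : ℝ | Module.End.HasEigenvalue
        (Matrix.toLin' (realAdjMatrix (paleyTypeGraph N))) μ}.ncard = 3 ^ n ∧
    -- the eigenvalues are the products below
    {μ : ℝ | Module.End.HasEigenvalue
        (Matrix.toLin' (realAdjMatrix (paleyTypeGraph N))) μ} =
      Set.range (fun s : Fin n → SignType => ∏ i, paleyEigenvalue (p i) (s i)) ∧
    -- these products are pairwise distinct
    Function.Injective
      (fun s : Fin n → SignType => ∏ i, paleyEigenvalue (p i) (s i)) ∧
    -- each row of the table, given by the set `T` of the `i` with a factor `(-1 ± √p i) / 2`,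
    -- holds `2 ^ |T|` distinct eigenvalues
    (∀ T : Finset (Fin n),
      {μ : ℝ | ∃ s : Fin n → SignType, (∀ i, s i ≠ 0 ↔ i ∈ T) ∧
        μ = ∏ i, paleyEigenvalue (p i) (s i)}.ncard = 2 ^ T.card) ∧
    -- the multiplicities, algebraic and geometric
    ∀ s : Fin n → SignType,
      (adjSpectrum (paleyTypeGraph N)).count (∏ i, paleyEigenvalue (p i) (s i)) =
          ∏ i, paleyMultiplicity (p i) (s i) ∧
      Module.finrank ℝ (Module.End.eigenspace
          (Matrix.toLin' (realAdjMatrix (paleyTypeGraph N)))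
          (∏ i, paleyEigenvalue (p i) (s i))) =
          ∏ i, paleyMultiplicity (p i) (s i) := by
  have hinj := prod_paleyEigenvalue_injective (fun i => (hp i).out) hp_inj
  have hN1 : 1 < N := by
    have h := Finset.dvd_prod_of_mem p (Finset.mem_univ (⟨0, hn⟩ : Fin n))
    rw [← hN] at h
    exact (hp _).out.one_lt.trans_le (Nat.le_of_dvd (NeZero.pos N) h)
  let e : ZMod N ≃+* ∀ i, ZMod (p i) := (ZMod.ringEquivCongr hN).trans
    (ZMod.prodEquivPi p fun i j hij =>
      (Nat.coprime_primes (hp i).out (hp j).out).mpr (hp_inj.ne hij))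
  choose σ hσ hσcard using fun i => exists_isDiagonalizedBy_paleyGraph (p i) (hp_mod i)
  -- The eigenvalues of `Γ_N`, indexed by tuples of residues.
  have hK := IsDiagonalizedBy.piKronecker hσ
  have hdiag : IsDiagonalizedBy (realAdjMatrix (paleyTypeGraph N))
      ((fun f => ∏ i, paleyEigenvalue (p i) (σ i (f i))) ∘ e) := by
    rw [realAdjMatrix_paleyTypeGraph hp_mod hN1 e]
    exact hK.submatrix e.toEquiv
  have hspec := adjSpectrum_eq_of_isDiagonalizedBy hdiag
  have hset : {μ : ℝ | Module.End.HasEigenvalue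
      (Matrix.toLin' (realAdjMatrix (paleyTypeGraph N))) μ} =
      Set.range (fun s : Fin n → SignType => ∏ i, paleyEigenvalue (p i) (s i)) := by
    -- Every sign occurs among the `σ i x`, since its multiplicity is positive.
    have hσsurj : ∀ i, Function.Surjective (σ i) := fun i s => by
      have hpos : 0 < paleyMultiplicity (p i) s := by
        have h2 := (hp i).out.two_le
        have h4 : p i % 4 = 1 := hp_mod i
        unfold paleyMultiplicity
        split_ifs <;> omega
      rw [← hσcard i s, Finset.card_pos] at hpos
      obtain ⟨x, hx⟩ := hpos
      exact ⟨x, (Finset.mem_filter.mp hx).2⟩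
    have hcomp : ((fun f => ∏ i, paleyEigenvalue (p i) (σ i (f i))) ∘ e) =
        (fun s : Fin n → SignType => ∏ i, paleyEigenvalue (p i) (s i)) ∘
          (Pi.map σ ∘ e) := rfl
    ext μ
    rw [Set.mem_ofPred_eq, hdiag.hasEigenvalue_iff, hcomp, Function.Surjective.range_comp]
    exact (Function.Surjective.piMap hσsurj).comp e.surjective
  have hcard : ∀ s : Fin n → SignType, (Finset.univ.filter fun x : ZMod N =>
      ((fun f => ∏ i, paleyEigenvalue (p i) (σ i (f i))) ∘ e) x =
        ∏ i, paleyEigenvalue (p i) (s i)).card = ∏ i, paleyMultiplicity (p i) (s i) := fun s => by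
    simp only [← hσcard, ← Fintype.card_piFinset]
    refine Finset.card_equiv e.toEquiv fun x => ?_
    simp only [Finset.mem_filter, Finset.mem_univ, true_and, Fintype.mem_piFinset]
    exact hinj.eq_iff.trans funext_iff
  refine ⟨?_, ?_, hset, hinj,
    ncard_prod_paleyEigenvalue_of_support (fun i => (hp i).out) hp_inj, fun s => ⟨?_, ?_⟩⟩
  · simp only [fun i => adjSpectrum_eq_of_isDiagonalizedBy (hσ i)]
    rw [spectraProd_map_univ, hspec, ← Multiset.map_map]
    congr 1
    exact congrArg Finset.val (Finset.map_univ_equiv e.toEquiv)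
  · rw [hset, Set.ncard_range_of_injective hinj]
    simp
    rfl
  · rw [hspec, Multiset.count_map, ← hcard s]
    simp only [eq_comm (a := ∏ i, paleyEigenvalue (p i) (s i))]
    rfl
  · rw [hdiag.finrank_eigenspace, hcard s]
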